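/- **Setting.** Let $\nu$ be a measure on a measurable space $X$, let $h:X\to[0,\infty)$ and $\tilde T:X\to\mathbb R^d$ be measurable, and put $Z(\theta)=\int h\,e^{\langle\theta,\tilde T\rangle}\,d\nu$, $T(x)=[\tilde T(x),-1]\in\mathbb R^{d+1}$, $\tau(\theta)=[\theta,\log Z(\theta)]\in\mathbb R^{d+1}$. For $\tau\in\mathbb R^{d+1}$ let $p_\tau(x)=h(x)\exp\langle\tau,T(x)\rangle$, so that $p_\theta:=p_{\tau(\theta)}$ is the density of the exponential family with parameter $\theta$; write $\mathbb E_\theta$ for the expectation under $p_\theta\,d\nu$. Let $\Theta\subseteq\mathbb R^d$ be a convex set of parameters such that $0<Z(\theta)<\infty$ and $\mathbb E_\theta\|T\|^2<\infty$ for all $\theta\in\Theta$. **Assumptions.** There are constants $\omega\in\mathbb R$, $\beta_Z>0$, $\lambda_{\min}>0$, $\lambda_{\max}$ and $\gamma_{\max},\gamma_{\min}\ge 0$ such that for all $\theta,\theta_1,\theta_2\in\Theta$, with $M_\theta=\mathbb E_\theta[T T^\top]$ and $\sigma_{\max},\sigma_{\min}$ the extreme singular values: 1. $\|\theta\|\le\omega$;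 2. $|\log Z(\theta_1)-\log Z(\theta_2)|\le\beta_Z\|\theta_1-\theta_2\|$; 3. $\lambda_{\min}\le\sigma_{\min}(M_\theta)$ and $\sigma_{\max}(M_\theta)\le\lambda_{\max}$; 4. $|\sigma_{\max}(M_{\theta_1})-\sigma_{\max}(M_{\theta_2})|\le\gamma_{\max}\|\theta_1-\theta_2\|$ and $|\sigma_{\min}(M_{\theta_1})-\sigma_{\min}(M_{\theta_2})|\le\gamma_{\min}\|\theta_1-\theta_2\|$. **NCE and NGD.** For $\theta_*,\theta_q\in\Theta$ let $p_*=p_{\theta_*}$, $q=p_{\theta_q}$ be the densities of $P_*$ and $Q$, let $\tau_*=\tau(\theta_*)$, $\tau_q=\tau(\theta_q)$, let $\mathrm{BC}=\mathrm{BC}(P_*,Q)=\int\sqrt{p_*q}\,d\nu$, and let $$L(\tau)=\tfrac12\int p_*\log\frac{p_\tau+q}{p_\tau}\,d\nu+\tfrac12\int q\log\frac{p_\tau+q}{q}\,d\nu ,\qquad \tau\in\mathbb R^{d+1}.$$ NGD with step size $\eta$ is the iteration $\tau_{t+1}=\tau_t-\eta\,\nabla L(\tau_t)/\|\nabla L(\tau_t)\|$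 (with $\tau_{t+1}=\tau_t$ if the gradient vanishes). **Theorem.** Let $0<\delta\le 1/\beta_Z$ and suppose that the closed balls of radius $\delta$ around $\theta_*$ and $\theta_q$ are contained in $\Theta$. Let $0\le\rho\le 1/\beta_Z$ and $$C=18\,e^{2/\beta_Z}\Big(\frac{\lambda_{\max}}{\lambda_{\min}}\Big)^3\min\Big\{\frac{2\lambda_{\max}^2}{\lambda_{\min}^2},\ \frac{2\lambda_{\min}+\gamma_{\max}\rho}{\lambda_{\min}-\gamma_{\min}\rho}\Big\},$$ where the second entry of the minimum is read as $+\infty$ if $\lambda_{\min}-\gamma_{\min}\rho\le 0$. Then NGD on $L$ started at $\tau_0=\tau_q$, with step size $\eta=\delta\sqrt{\mathrm{BC}^3/C}$, satisfies $\|\tau_t-\tau_*\|\le\delta$ for some $$t\le C\cdot\frac{1}{\mathrm{BC}(P_*,Q)^3}\cdot\frac{\|\tau_0-\tau_*\|^2}{\delta^2}.$$ -/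

import Mathlib

open MeasureTheory

noncomputable section

/-- The data of a `d`-dimensional exponential family on `X`: a base measure `ν` (Lebesgue measure in
the classical case), a nonnegative function `h` and a statistic `T̃ : X → ℝ^d`.  The member with
parameter `θ` has the `ν`-density `x ↦ h x * exp (⟪θ, T̃ x⟫ - log Z(θ))`. -/
structure ExpFamily (X : Type*) [MeasurableSpace X] (d : ℕ) where
  /-- base measure -/
  ν : Measure X
  /-- carrier function -/
  h : X → ℝ
  /-- statistic -/
  stat : X → EuclideanSpace ℝ (Fin d)
  measurable_h : Measurable h
  h_nonneg : ∀ x, 0 ≤ h x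
  measurable_stat : Measurable stat

/-- Extended parameters `τ = [θ, α]`, where `α` stands for the log-normalizer. -/
abbrev ExtParam (d : ℕ) : Type := EuclideanSpace ℝ (Fin d ⊕ Unit)

namespace ExpFamily

variable {X : Type*} [MeasurableSpace X] {d : ℕ} (F : ExpFamily X d)

/-- The partition function `Z(θ) = ∫ h exp ⟪θ, T̃⟫ dν`. -/
def Z (θ : EuclideanSpace ℝ (Fin d)) : ℝ :=
  ∫ x, F.h x * Real.exp (inner ℝ θ (F.stat x)) ∂F.ν

/-- The extended statistic `T(x) = [T̃(x), -1]`. -/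
def T (x : X) : ExtParam d :=
  WithLp.toLp 2 (Sum.elim (fun i => F.stat x i) (fun _ => -1))

/-- The extended parameter `τ(θ) = [θ, log Z(θ)]`. -/
def ext (θ : EuclideanSpace ℝ (Fin d)) : ExtParam d :=
  WithLp.toLp 2 (Sum.elim (fun i => θ i) (fun _ => Real.log (F.Z θ)))

/-- The (in general unnormalized) model `p_τ(x) = h(x) exp ⟪τ, T(x)⟫`. -/
def model (τ : ExtParam d) (x : X) : ℝ :=
  F.h x * Real.exp (inner ℝ τ (F.T x))

/-- The normalized density `p_θ = p_{τ(θ)}`. -/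
def density (θ : EuclideanSpace ℝ (Fin d)) (x : X) : ℝ :=
  F.model (F.ext θ) x

/-- The matrix `E_θ[T(x) T(x)ᵀ]`. -/
def fisher (θ : EuclideanSpace ℝ (Fin d)) : Matrix (Fin d ⊕ Unit) (Fin d ⊕ Unit) ℝ :=
  Matrix.of fun i j => ∫ x, F.density θ x * (F.T x i * F.T x j) ∂F.ν

/-- The largest singular value of `E_θ[T Tᵀ]`. -/
def sigmaMax (θ : EuclideanSpace ℝ (Fin d)) : ℝ :=
  (Matrix.toEuclideanLin (F.fisher θ)).singularValues 0

/-- The smallest singular value of `E_θ[T Tᵀ]`; this matrix has size `d + 1`, and Mathlib numbers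
singular values in decreasing order from `0`. -/
def sigmaMin (θ : EuclideanSpace ℝ (Fin d)) : ℝ :=
  (Matrix.toEuclideanLin (F.fisher θ)).singularValues d

/-- The Bhattacharyya coefficient of the members with parameters `θ₁` and `θ₂`. -/
def bhattacharyya (θ₁ θ₂ : EuclideanSpace ℝ (Fin d)) : ℝ :=
  ∫ x, Real.sqrt (F.density θ₁ x * F.density θ₂ x) ∂F.ν

/-- The population NCE loss of the model `p_τ`, with data distribution `P_* = P_{θ_*}` and noise
distribution `Q = P_{θ_q}`. -/
def nceLoss (θstar θq : EuclideanSpace ℝ (Fin d)) (τ : ExtParam d) : ℝ :=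
  1 / 2 * ∫ x, F.density θstar x *
      Real.log ((F.model τ x + F.density θq x) / F.model τ x) ∂F.ν
    + 1 / 2 * ∫ x, F.density θq x *
      Real.log ((F.model τ x + F.density θq x) / F.density θq x) ∂F.ν

/-- The standing assumptions on the exponential family over the parameter set `Θ`. -/
structure Assumptions (Θ : Set (EuclideanSpace ℝ (Fin d)))
    (ω βZ lmax lmin γmax γmin : ℝ) : Prop where
  /-- `Z(θ)` is finite on `Θ` -/
  integrable_weight : ∀ θ ∈ Θ,
    Integrable (fun x => F.h x * Real.exp (inner ℝ θ (F.stat x))) F.ν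
  /-- `Z(θ)` is positive on `Θ` -/
  Z_pos : ∀ θ ∈ Θ, 0 < F.Z θ
  /-- the second moments `E_θ[T Tᵀ]` exist on `Θ` -/
  integrable_sq : ∀ θ ∈ Θ, Integrable (fun x => F.density θ x * ‖F.T x‖ ^ 2) F.ν
  /-- bounded parameters -/
  norm_le : ∀ θ ∈ Θ, ‖θ‖ ≤ ω
  /-- Lipschitz log-partition function -/
  βZ_pos : 0 < βZ
  logZ_lipschitz : ∀ θ₁ ∈ Θ, ∀ θ₂ ∈ Θ,
    |Real.log (F.Z θ₁) - Real.log (F.Z θ₂)| ≤ βZ * ‖θ₁ - θ₂‖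
  /-- bounded singular values of the population Fisher matrix -/
  lmin_pos : 0 < lmin
  le_sigmaMin : ∀ θ ∈ Θ, lmin ≤ F.sigmaMin θ
  sigmaMax_le : ∀ θ ∈ Θ, F.sigmaMax θ ≤ lmax
  /-- bounded variation of the extreme singular values (third-order bounds) -/
  γmax_nonneg : 0 ≤ γmax
  γmin_nonneg : 0 ≤ γmin
  sigmaMax_lipschitz : ∀ θ₁ ∈ Θ, ∀ θ₂ ∈ Θ,
    |F.sigmaMax θ₁ - F.sigmaMax θ₂| ≤ γmax * ‖θ₁ - θ₂‖
  sigmaMin_lipschitz : ∀ θ₁ ∈ Θ, ∀ θ₂ ∈ Θ,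
    |F.sigmaMin θ₁ - F.sigmaMin θ₂| ≤ γmin * ‖θ₁ - θ₂‖

end ExpFamily

/-- Normalized gradient descent `τ_{t+1} = τ_t - η ∇L(τ_t) / ‖∇L(τ_t)‖` (the iterate stays where it
is if the gradient vanishes). -/
def ngd {E : Type*} [NormedAddCommGroup E] [InnerProductSpace ℝ E] [CompleteSpace E]
    (L : E → ℝ) (η : ℝ) (τ₀ : E) : ℕ → E
  | 0 => τ₀
  | t + 1 => ngd L η τ₀ t - (η / ‖gradient L (ngd L η τ₀ t)‖) • gradient L (ngd L η τ₀ t)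

/-- The factor `C`, as a function of `ρ = ‖δ̄‖`.  The second entry of the minimum is read as `+∞` when
its denominator is not positive. -/
def rateConst (βZ lmax lmin γmax γmin ρ : ℝ) : ℝ :=
  18 * Real.exp (2 / βZ) * (lmax / lmin) ^ 3 *
    (if γmin * ρ < lmin then
      min (2 * lmax ^ 2 / lmin ^ 2) ((2 * lmin + γmax * ρ) / (lmin - γmin * ρ))
    else 2 * lmax ^ 2 / lmin ^ 2)

end

/-! The loss is a logistic loss in `⟪τ - τ_q, T⟫`, hence convex, and its gradient vanishes at `τ_*`.
Suppose `L(τ) > L(τ_*)` and the sphere of radius `η` about `τ_*` lies in the sublevel set of `τ`.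
The supporting hyperplane at `τ` then gives `η‖∇L(τ)‖ ≤ ⟪∇L(τ), τ - τ_*⟫`, and a normalized step
lowers `‖τ - τ_*‖²` by at least `η²`. If this holds whenever `‖τ - τ_*‖ > δ`, the ball is entered
within `‖τ₀ - τ_*‖² / η²` steps, which is the claimed number.

It remains to compare `L` on the small sphere with `L` outside the ball. From above, `L(τ_* + v) -
L(τ_*) ≤ (λmax / 2)‖v‖²` (`nceLoss_add_sub_le`). From below, for `τ = τ_* + u` and `w = ⟪u, T⟫`, the
slope `⟪∇L(τ), u⟫` is `½ ∫ p_* q (e^w - 1) w / (p_τ + q)`. Since `(e^w - 1) w ≥ w² e^{w/2}`,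
Cauchy–Schwarz bounds it below by `½ (∫ m w²)² / ∫ (p_τ + q) w²`, where `m = √(p_* q) e^{w/4}` is
again a model density, of mass comparable to BC. The bounds on `M_θ` turn this into a multiple of
`BC² (λmin² / λmax)‖u‖²` (`le_inner_nceGrad`), and convexity turns the slope at radius `δ/2` into a
gap beyond radius `δ` (`le_nceLoss_sub`). As `BC ≤ 1`, the choice `η² = δ² BC³ / C` is small enough;
of `C` only `C ≥ 36 e^{2/βZ} (λmax / λmin)³` matters. -/

open scoped RealInnerProductSpace

/-! ### Quadratic forms and extreme singular values -/

section LinearAlgebra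

variable {E : Type*} [NormedAddCommGroup E] [InnerProductSpace ℝ E] [FiniteDimensional ℝ E]

theorem LinearMap.IsSymmetric.inner_apply_self_eq_sum {A : E →ₗ[ℝ] E} (hA : A.IsSymmetric)
    {n : ℕ} (hn : Module.finrank ℝ E = n) (v : E) :
    ⟪A v, v⟫ = ∑ i, hA.eigenvalues hn i * ⟪hA.eigenvectorBasis hn i, v⟫ ^ 2 := by
  rw [← (hA.eigenvectorBasis hn).sum_inner_mul_inner (A v) v]
  refine Finset.sum_congr rfl fun i _ => ?_
  rw [hA v, hA.apply_eigenvectorBasis, inner_smul_right, real_inner_comm]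
  simp only [RCLike.ofReal_real_eq_id, id_eq]
  ring

theorem LinearMap.IsSymmetric.inner_apply_self_le {A : E →ₗ[ℝ] E} (hA : A.IsSymmetric)
    {n : ℕ} (hn : Module.finrank ℝ E = n) {c : ℝ} (hc : ∀ i, hA.eigenvalues hn i ≤ c) (v : E) :
    ⟪A v, v⟫ ≤ c * ‖v‖ ^ 2 := by
  rw [hA.inner_apply_self_eq_sum hn, ← (hA.eigenvectorBasis hn).sum_sq_inner_right v,
    Finset.mul_sum]
  exact Finset.sum_le_sum fun i _ => mul_le_mul_of_nonneg_right (hc i) (sq_nonneg _)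

theorem LinearMap.IsSymmetric.le_inner_apply_self {A : E →ₗ[ℝ] E} (hA : A.IsSymmetric)
    {n : ℕ} (hn : Module.finrank ℝ E = n) {c : ℝ} (hc : ∀ i, c ≤ hA.eigenvalues hn i) (v : E) :
    c * ‖v‖ ^ 2 ≤ ⟪A v, v⟫ := by
  rw [hA.inner_apply_self_eq_sum hn, ← (hA.eigenvectorBasis hn).sum_sq_inner_right v,
    Finset.mul_sum]
  exact Finset.sum_le_sum fun i _ => mul_le_mul_of_nonneg_right (hc i) (sq_nonneg _)

theorem LinearMap.norm_apply_sq_bounds (A : E →ₗ[ℝ] E) {n : ℕ}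
    (hn : Module.finrank ℝ E = n + 1) (v : E) :
    A.singularValues n ^ 2 * ‖v‖ ^ 2 ≤ ‖A v‖ ^ 2 ∧ ‖A v‖ ^ 2 ≤ A.singularValues 0 ^ 2 * ‖v‖ ^ 2 := by
  have h : ⟪(LinearMap.adjoint A ∘ₗ A) v, v⟫ = ‖A v‖ ^ 2 := by
    rw [LinearMap.comp_apply, LinearMap.adjoint_inner_left, real_inner_self_eq_norm_sq]
  rw [← h]
  have key : ∀ i j : ℕ, i ≤ j → A.singularValues j ^ 2 ≤ A.singularValues i ^ 2 := fun i j hij =>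
    pow_le_pow_left₀ (A.singularValues_nonneg j) (A.singularValues_antitone hij) 2
  constructor
  · refine A.isSymmetric_adjoint_comp_self.le_inner_apply_self hn (fun i => ?_) v
    rw [← A.sq_singularValues_fin hn]
    exact key _ _ (by omega)
  · refine A.isSymmetric_adjoint_comp_self.inner_apply_self_le hn (fun i => ?_) v
    rw [← A.sq_singularValues_fin hn]
    exact key _ _ (Nat.zero_le _)

/-- The norm bounds, tested on eigenvectors, enclose the squared eigenvalues; positivity removes the
squares. In dimension `n + 1` the last singular value has index `n`. -/
theorem LinearMap.IsPositive.inner_apply_self_bounds {A : E →ₗ[ℝ] E} (hA : A.IsPositive) {n : ℕ}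
    (hn : Module.finrank ℝ E = n + 1) (v : E) :
    A.singularValues n * ‖v‖ ^ 2 ≤ ⟪A v, v⟫ ∧ ⟪A v, v⟫ ≤ A.singularValues 0 * ‖v‖ ^ 2 := by
  have hS := hA.isSymmetric
  have key : ∀ i, A.singularValues n ^ 2 ≤ hS.eigenvalues hn i ^ 2 ∧
      hS.eigenvalues hn i ^ 2 ≤ A.singularValues 0 ^ 2 := by
    intro i
    have h := A.norm_apply_sq_bounds hn (hS.eigenvectorBasis hn i)
    rw [hS.apply_eigenvectorBasis, norm_smul, OrthonormalBasis.norm_eq_one] at h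
    simpa using h
  constructor
  · exact hS.le_inner_apply_self hn
      (fun i => le_of_sq_le_sq (key i).1 (hA.nonneg_eigenvalues hn i)) v
  · exact hS.inner_apply_self_le hn
      (fun i => le_of_sq_le_sq (key i).2 (A.singularValues_nonneg 0)) v

end LinearAlgebra

/-! ### Quadratic bounds for softplus -/

section Scalar

/-- The softplus function. -/
noncomputable def softplus (s : ℝ) : ℝ := Real.log (1 + Real.exp s)

/-- The logistic function, the derivative of `softplus`. -/
noncomputable def logistic (s : ℝ) : ℝ := Real.exp s / (1 + Real.exp s)

theorem logistic_nonneg (s : ℝ) : 0 ≤ logistic s := by unfold logistic; positivity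

theorem logistic_le_one (s : ℝ) : logistic s ≤ 1 := by
  unfold logistic
  rw [div_le_one (by positivity)]
  linarith

theorem measurable_softplus : Measurable softplus := by unfold softplus; fun_prop

theorem measurable_logistic : Measurable logistic := by unfold logistic; fun_prop

/-- The increment is the log-moment generating function of a Bernoulli variable with parameter
`logistic s`, so Hoeffding and Jensen give the upper and lower bounds below. -/
theorem softplus_add (s w : ℝ) :
    softplus (s + w) = softplus s + Real.log (1 - logistic s + logistic s * Real.exp w) := by
  have h1 : (0 : ℝ) < 1 + Real.exp s := by positivity
  have h2 : 1 - logistic s + logistic s * Real.exp w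
      = (1 + Real.exp (s + w)) / (1 + Real.exp s) := by
    unfold logistic; rw [Real.exp_add]; field_simp; ring
  rw [h2, Real.log_div (by positivity) h1.ne']
  unfold softplus
  ring

theorem exp_mul_le_cosh_add_mul_sinh {x : ℝ} (hx : |x| ≤ 1) (w : ℝ) :
    Real.exp (w * x) ≤ Real.cosh w + x * Real.sinh w := by
  obtain ⟨h1, h2⟩ := abs_le.1 hx
  have h := convexOn_exp.2 (Set.mem_univ w) (Set.mem_univ (-w))
    (show 0 ≤ (1 + x) / 2 by linarith) (show 0 ≤ (1 - x) / 2 by linarith) (by ring)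
  simp only [smul_eq_mul] at h
  rw [Real.cosh_eq, Real.sinh_eq]
  calc Real.exp (w * x) = Real.exp ((1 + x) / 2 * w + (1 - x) / 2 * -w) := by congr 1; ring
    _ ≤ _ := h
    _ = _ := by ring

/-- Hoeffding's argument for a centred Bernoulli variable, with values `-p` and `1 - p` in `[-1,
1]`: mean zero cancels the `sinh` terms. -/
theorem one_sub_add_mul_exp_le {p : ℝ} (hp : 0 ≤ p) (hp' : p ≤ 1) (w : ℝ) :
    1 - p + p * Real.exp w ≤ Real.exp (p * w + w ^ 2 / 2) := by
  have h0 := exp_mul_le_cosh_add_mul_sinh (x := -p) (by rw [abs_le]; constructor <;> linarith) w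
  have h1 := exp_mul_le_cosh_add_mul_sinh (x := 1 - p) (by rw [abs_le]; constructor <;> linarith) w
  have h2 : 1 - p + p * Real.exp w
      = Real.exp (p * w) * ((1 - p) * Real.exp (w * -p) + p * Real.exp (w * (1 - p))) := by
    rw [mul_add, mul_left_comm, ← Real.exp_add, mul_left_comm, ← Real.exp_add]
    have : p * w + w * -p = 0 := by ring
    rw [this, Real.exp_zero]
    ring_nf
  rw [h2, Real.exp_add]
  refine mul_le_mul_of_nonneg_left ?_ (Real.exp_nonneg _)
  refine le_trans ?_ (Real.cosh_le_exp_half_sq w)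
  nlinarith [mul_le_mul_of_nonneg_left h0 (show 0 ≤ 1 - p by linarith),
    mul_le_mul_of_nonneg_left h1 hp]

theorem softplus_add_le (s w : ℝ) :
    softplus (s + w) - softplus s - logistic s * w ≤ w ^ 2 / 2 := by
  rw [softplus_add]
  have h0 := logistic_nonneg s
  have h1 := logistic_le_one s
  have h3 : 0 < 1 - logistic s + logistic s * Real.exp w := by
    rcases h0.eq_or_lt with h | h
    · rw [← h]; norm_num
    · have := mul_pos h (Real.exp_pos w); linarith
  have h2 := Real.log_le_log h3 (one_sub_add_mul_exp_le h0 h1 w)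
  rw [Real.log_exp] at h2
  linarith

theorem le_softplus_add (s w : ℝ) :
    0 ≤ softplus (s + w) - softplus s - logistic s * w := by
  rw [softplus_add]
  have h0 := logistic_nonneg s
  have h1 := logistic_le_one s
  have h := convexOn_exp.2 (Set.mem_univ 0) (Set.mem_univ w)
    (show 0 ≤ 1 - logistic s by linarith) h0 (by ring)
  simp only [smul_eq_mul, Real.exp_zero, mul_zero, mul_one, zero_add] at h
  have h2 := Real.log_le_log (Real.exp_pos _) h
  rw [Real.log_exp] at h2
  linarith

theorem abs_softplus_le (s : ℝ) : |softplus s| ≤ Real.log 2 + |s| := by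
  have h0 : 0 ≤ softplus s := Real.log_nonneg (by linarith [Real.exp_pos s])
  rw [abs_of_nonneg h0]
  have h : 1 + Real.exp s ≤ 2 * Real.exp |s| := by
    have := Real.exp_le_exp.2 (le_abs_self s)
    have := Real.one_le_exp (abs_nonneg s)
    linarith
  calc softplus s ≤ Real.log (2 * Real.exp |s|) := Real.log_le_log (by positivity) h
    _ = _ := by rw [Real.log_mul (by norm_num) (Real.exp_ne_zero _), Real.log_exp]

/-- After factoring out `e^{w/2}` this is `|sinh x| ≥ |x|` at `x = w/2`. -/
theorem sq_mul_exp_half_le (w : ℝ) : w ^ 2 * Real.exp (w / 2) ≤ (Real.exp w - 1) * w := by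
  have h1 : Real.exp w - 1 = Real.exp (w / 2) * (Real.exp (w / 2) - Real.exp (-(w / 2))) := by
    rw [mul_sub, ← Real.exp_add, ← Real.exp_add, add_halves, add_neg_cancel, Real.exp_zero]
  have h2 : w ^ 2 ≤ (Real.exp (w / 2) - Real.exp (-(w / 2))) * w := by
    have h3 : Real.exp (w / 2) - Real.exp (-(w / 2)) = 2 * Real.sinh (w / 2) := by
      rw [Real.sinh_eq]; ring
    rw [h3]
    rcases le_total 0 w with hw | hw
    · have := Real.self_le_sinh_iff.2 (show 0 ≤ w / 2 by linarith)
      nlinarith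
    · have := Real.sinh_le_self_iff.2 (show w / 2 ≤ 0 by linarith)
      nlinarith
  rw [h1]
  nlinarith [Real.exp_pos (w / 2), mul_le_mul_of_nonneg_left h2 (Real.exp_pos (w / 2)).le]

end Scalar

/-! ### Normalized gradient descent and convexity -/

section NGD

variable {E : Type*} [NormedAddCommGroup E] [InnerProductSpace ℝ E]

/-- Normalized gradient descent with step size `η` enters the ball of radius `δ ≥ η` around `z` in at
most `‖τ₀ - z‖² / η²` steps, if outside that ball the normalized negative gradient makes an
angle with the direction of `z` that is bounded away from `π / 2`. -/
theorem exists_ngd_norm_sub_le [CompleteSpace E] {L : E → ℝ} {η δ : ℝ} (hη : 0 < η) (hηδ : η ≤ δ) (z τ₀ : E)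
    (hL : ∀ τ, δ < ‖τ - z‖ → gradient L τ ≠ 0 ∧ η * ‖gradient L τ‖ ≤ ⟪gradient L τ, τ - z⟫) :
    ∃ t : ℕ, (t : ℝ) ≤ ‖τ₀ - z‖ ^ 2 / η ^ 2 ∧ ‖ngd L η τ₀ t - z‖ ≤ δ := by
  by_contra! hcon
  have hη2 : 0 < η ^ 2 := by positivity
  have step : ∀ τ, δ < ‖τ - z‖ →
      ‖τ - (η / ‖gradient L τ‖) • gradient L τ - z‖ ^ 2 ≤ ‖τ - z‖ ^ 2 - η ^ 2 := by
    intro τ hτ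
    obtain ⟨h0, h1⟩ := hL τ hτ
    have hg : 0 < ‖gradient L τ‖ := norm_pos_iff.2 h0
    have h2 : τ - (η / ‖gradient L τ‖) • gradient L τ - z
        = (τ - z) - (η / ‖gradient L τ‖) • gradient L τ := by abel
    rw [h2, norm_sub_sq_real, inner_smul_right, norm_smul, Real.norm_of_nonneg (by positivity),
      div_mul_cancel₀ _ hg.ne', real_inner_comm]
    have h3 : η ≤ ⟪gradient L τ, τ - z⟫ / ‖gradient L τ‖ := (le_div_iff₀ hg).2 h1
    have h4 : η / ‖gradient L τ‖ * ⟪gradient L τ, τ - z⟫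
        = η * (⟪gradient L τ, τ - z⟫ / ‖gradient L τ‖) := by ring
    rw [h4]
    nlinarith [mul_le_mul_of_nonneg_left h3 hη.le]
  have dec : ∀ t : ℕ, (t : ℝ) ≤ ‖τ₀ - z‖ ^ 2 / η ^ 2 →
      ‖ngd L η τ₀ t - z‖ ^ 2 ≤ ‖τ₀ - z‖ ^ 2 - t * η ^ 2 := by
    intro t
    induction t with
    | zero => intro _; simp [ngd]
    | succ t ih =>
      intro ht
      push_cast at ht ⊢
      have ht' : (t : ℝ) ≤ ‖τ₀ - z‖ ^ 2 / η ^ 2 := by linarith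
      have h1 := ih ht'
      have h2 := step _ (hcon t ht')
      simp only [ngd]
      linarith
  -- At the last admissible time the remaining squared distance is below `η² ≤ δ²`, a contradiction.
  set N := ⌊‖τ₀ - z‖ ^ 2 / η ^ 2⌋₊ with hN
  have hN1 : (N : ℝ) ≤ ‖τ₀ - z‖ ^ 2 / η ^ 2 := Nat.floor_le (by positivity)
  have hN2 : ‖τ₀ - z‖ ^ 2 / η ^ 2 < N + 1 := Nat.lt_floor_add_one _
  rw [div_lt_iff₀ hη2] at hN2
  have h1 := dec N hN1
  have h2 := hcon N hN1
  nlinarith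

/-- For a convex `L` whose minimum at `z` is shallow compared with its values outside the ball of
radius `δ`, the gradient outside that ball makes a definite angle with the direction of `z`. -/
theorem mul_norm_le_inner_of_forall_le {L : E → ℝ} {G : E → E} {η : ℝ} (hη : 0 ≤ η) {z τ : E}
    (hconv : ∀ y, L τ + ⟪G τ, y - τ⟫ ≤ L y) (hz : L z < L τ)
    (hball : ∀ v, ‖v‖ = η → L (z + v) ≤ L τ) :
    G τ ≠ 0 ∧ η * ‖G τ‖ ≤ ⟪G τ, τ - z⟫ := by
  have h0 : G τ ≠ 0 := by
    intro h
    have := hconv z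
    rw [h, inner_zero_left] at this
    linarith
  refine ⟨h0, ?_⟩
  have hg : 0 < ‖G τ‖ := norm_pos_iff.2 h0
  -- On the sphere of radius `η` about `z`, the supporting hyperplane is highest in the direction of
  -- the gradient.
  have h1 := hconv (z + (η / ‖G τ‖) • G τ)
  have h2 := hball ((η / ‖G τ‖) • G τ)
    (by rw [norm_smul, Real.norm_of_nonneg (by positivity), div_mul_cancel₀ _ hg.ne'])
  have h3 : z + (η / ‖G τ‖) • G τ - τ = (η / ‖G τ‖) • G τ - (τ - z) := by abel
  rw [h3, inner_sub_right, inner_smul_right, real_inner_self_eq_norm_sq] at h1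
  have h4 : η / ‖G τ‖ * ‖G τ‖ ^ 2 = η * ‖G τ‖ := by field_simp
  linarith

/-- A remainder of order `‖v‖²` identifies the gradient without differentiating under the integral.
-/
theorem hasGradientAt_of_quadratic_bounds [CompleteSpace E] {L : E → ℝ} {g τ : E} {c : ℝ}
    (h0 : ∀ v, 0 ≤ L (τ + v) - L τ - ⟪g, v⟫) (h1 : ∀ v, L (τ + v) - L τ - ⟪g, v⟫ ≤ c * ‖v‖ ^ 2) :
    HasGradientAt L g τ := by
  rw [hasGradientAt_iff_isLittleO]
  have hO : (fun x' : E => L x' - L τ - ⟪g, x' - τ⟫) =O[nhds τ] fun x' => ‖x' - τ‖ ^ 2 := by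
    refine Asymptotics.IsBigO.of_bound c (Filter.Eventually.of_forall fun x => ?_)
    have a := h0 (x - τ)
    have b := h1 (x - τ)
    rw [add_sub_cancel] at a b
    rw [Real.norm_of_nonneg a, Real.norm_of_nonneg (by positivity)]
    exact b
  exact hO.trans_isLittleO (Asymptotics.isLittleO_pow_sub_sub τ one_lt_two)

end NGD

/-- Pointwise lower bound for the derivative of the NCE integrand, where `h e^a`, `h e^b` and
`h e^(a+w)` are the densities of the data, of the noise and of the model. -/
theorem le_nce_slope_mul {h : ℝ} (hh : 0 ≤ h) (a b w κ : ℝ) :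
    2 * κ * (h * Real.exp ((a + b) / 2 + w / 4) * w ^ 2)
        - κ ^ 2 * (h * Real.exp (a + w) * w ^ 2 + h * Real.exp b * w ^ 2)
      ≤ ((h * Real.exp a + h * Real.exp b) * logistic (a + w - b) - h * Real.exp a) * w := by
  have hS : 0 < Real.exp (a + w) + Real.exp b := by positivity
  have h1 : logistic (a + w - b) = Real.exp (a + w) / (Real.exp (a + w) + Real.exp b) := by
    unfold logistic
    rw [Real.exp_sub]
    field_simp
    ring
  set S := Real.exp (a + w) + Real.exp b
  set m := Real.exp ((a + b) / 2 + w / 4)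
  have hm : m ^ 2 = Real.exp a * Real.exp b * Real.exp (w / 2) := by
    rw [← Real.exp_nat_mul, ← Real.exp_add, ← Real.exp_add]
    congr 1
    push_cast
    ring
  have h2 : ((h * Real.exp a + h * Real.exp b) * logistic (a + w - b) - h * Real.exp a) * w
      = h * (Real.exp a * Real.exp b * ((Real.exp w - 1) * w) / S) := by
    rw [h1]
    field_simp
    simp only [S, Real.exp_add]
    ring
  rw [h2]
  -- Cauchy–Schwarz in linearized form: `m² / S ≥ 2κm - κ²S` from `(m - κS)² ≥ 0`, with `κ` to be
  -- optimized after integration.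
  have h3 : (2 * κ * m - κ ^ 2 * S) * w ^ 2
      ≤ Real.exp a * Real.exp b * ((Real.exp w - 1) * w) / S := by
    rw [le_div_iff₀ hS]
    have h4 := mul_le_mul_of_nonneg_left (sq_mul_exp_half_le w)
      (mul_pos (Real.exp_pos a) (Real.exp_pos b)).le
    have h5 : m ^ 2 * w ^ 2 ≤ Real.exp a * Real.exp b * ((Real.exp w - 1) * w) := by
      rw [hm]; linarith
    nlinarith [mul_nonneg (sq_nonneg (m - κ * S)) (sq_nonneg w)]
  calc _ = h * ((2 * κ * m - κ ^ 2 * S) * w ^ 2) := by simp only [S]; ring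
    _ ≤ _ := mul_le_mul_of_nonneg_left h3 hh

/-- The natural parameter `θ` of an extended parameter `[θ, α]`. -/
noncomputable def ExtParam.natural {d : ℕ} : ExtParam d →ₗ[ℝ] EuclideanSpace ℝ (Fin d) where
  toFun τ := WithLp.toLp 2 fun i => τ (Sum.inl i)
  map_add' _ _ := rfl
  map_smul' _ _ := rfl

@[simp]
theorem ExtParam.natural_apply {d : ℕ} (τ : ExtParam d) (i : Fin d) :
    ExtParam.natural τ i = τ (Sum.inl i) := rfl

theorem ExtParam.norm_sq_eq {d : ℕ} (τ : ExtParam d) :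
    ‖τ‖ ^ 2 = ‖ExtParam.natural τ‖ ^ 2 + τ (Sum.inr ()) ^ 2 := by
  simp [EuclideanSpace.norm_sq_eq]

theorem ExtParam.norm_natural_le {d : ℕ} (τ : ExtParam d) : ‖ExtParam.natural τ‖ ≤ ‖τ‖ :=
  le_of_sq_le_sq (by rw [ExtParam.norm_sq_eq τ]; nlinarith [sq_nonneg (τ (Sum.inr ()))])
    (norm_nonneg _)

theorem ExtParam.abs_inr_le {d : ℕ} (τ : ExtParam d) : |τ (Sum.inr ())| ≤ ‖τ‖ :=
  PiLp.norm_apply_le τ (Sum.inr ())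

/-! ### Exponential families with extended parameters -/

namespace ExpFamily

variable {X : Type*} [MeasurableSpace X] {d : ℕ} (F : ExpFamily X d)

/-- The logarithm of the total mass of `p_τ`. -/
noncomputable def logMass (τ : ExtParam d) : ℝ :=
  Real.log (F.Z (ExtParam.natural τ)) - τ (Sum.inr ())

theorem natural_ext (θ : EuclideanSpace ℝ (Fin d)) : ExtParam.natural (F.ext θ) = θ := rfl

theorem inner_T (τ : ExtParam d) (x : X) :
    ⟪τ, F.T x⟫ = ⟪ExtParam.natural τ, F.stat x⟫ - τ (Sum.inr ()) := by
  simp [PiLp.inner_apply, T, sub_eq_add_neg]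

theorem model_nonneg (τ : ExtParam d) (x : X) : 0 ≤ F.model τ x :=
  mul_nonneg (F.h_nonneg x) (Real.exp_nonneg _)

theorem density_nonneg (θ : EuclideanSpace ℝ (Fin d)) (x : X) : 0 ≤ F.density θ x :=
  F.model_nonneg _ x

theorem density_eq (θ : EuclideanSpace ℝ (Fin d)) (x : X) :
    F.density θ x = F.h x * Real.exp ⟪θ, F.stat x⟫ * Real.exp (-Real.log (F.Z θ)) := by
  rw [density, model, inner_T, natural_ext, mul_assoc, ← Real.exp_add]
  rfl

theorem model_eq (τ : ExtParam d) (x : X) :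
    F.model τ x = Real.exp (F.logMass τ) * F.density (ExtParam.natural τ) x := by
  rw [density_eq, model, inner_T, mul_assoc, ← Real.exp_add, mul_left_comm, ← Real.exp_add, logMass]
  congr 2
  ring

theorem measurable_T : Measurable F.T := by
  refine (WithLp.measurable_toLp 2 _).comp (measurable_pi_iff.2 fun i => ?_)
  cases i with
  | inl i =>
    exact (measurable_pi_apply i).comp ((WithLp.measurable_ofLp 2 _).comp F.measurable_stat)
  | inr _ => exact measurable_const

theorem measurable_inner_T (τ : ExtParam d) : Measurable fun x => ⟪τ, F.T x⟫ :=
  measurable_const.inner F.measurable_T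

theorem measurable_model (τ : ExtParam d) : Measurable (F.model τ) :=
  F.measurable_h.mul (Real.measurable_exp.comp (F.measurable_inner_T τ))

theorem measurable_density (θ : EuclideanSpace ℝ (Fin d)) : Measurable (F.density θ) :=
  F.measurable_model _

/-- The gradient of the NCE loss. -/
noncomputable def nceGrad (θstar θq : EuclideanSpace ℝ (Fin d)) (τ : ExtParam d) : ExtParam d :=
  (1 / 2 : ℝ) • ∫ x, ((F.density θstar x + F.density θq x) * logistic ⟪τ - F.ext θq, F.T x⟫
    - F.density θstar x) • F.T x ∂F.ν

/-- At the true parameter the logistic factor is the posterior `p_* / (p_* + q)`, so the integrand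
vanishes pointwise. -/
theorem nceGrad_ext_star (θstar θq : EuclideanSpace ℝ (Fin d)) :
    F.nceGrad θstar θq (F.ext θstar) = 0 := by
  have h : ∀ x, (F.density θstar x + F.density θq x) * logistic ⟪F.ext θstar - F.ext θq, F.T x⟫
      - F.density θstar x = 0 := by
    intro x
    simp only [density, model, logistic, inner_sub_left, Real.exp_sub]
    field_simp
    ring
  simp [nceGrad, h]

theorem le_rateConst {βZ lmax lmin γmax γmin ρ : ℝ} (hlmin : 0 < lmin) (hl : lmin ≤ lmax)
    (hγmax : 0 ≤ γmax) (hγmin : 0 ≤ γmin) (hρ : 0 ≤ ρ) :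
    36 * Real.exp (2 / βZ) * (lmax / lmin) ^ 3 ≤ rateConst βZ lmax lmin γmax γmin ρ := by
  have hk : 0 ≤ 18 * Real.exp (2 / βZ) * (lmax / lmin) ^ 3 := by
    have : 0 < lmax := hlmin.trans_le hl
    positivity
  have h1 : 2 ≤ 2 * lmax ^ 2 / lmin ^ 2 := by
    rw [le_div_iff₀ (by positivity)]
    nlinarith
  unfold rateConst
  calc _ = 18 * Real.exp (2 / βZ) * (lmax / lmin) ^ 3 * 2 := by ring
    _ ≤ _ := mul_le_mul_of_nonneg_left ?_ hk
  split_ifs with h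
  · refine le_min h1 ?_
    rw [le_div_iff₀ (by linarith)]
    nlinarith [mul_nonneg hγmax hρ, mul_nonneg hγmin hρ]
  · exact h1

/-! ### Integrability, second moments and mass -/

namespace Assumptions

variable {F} {Θ : Set (EuclideanSpace ℝ (Fin d))} {ω βZ lmax lmin γmax γmin : ℝ}

theorem lmin_le_lmax (hF : F.Assumptions Θ ω βZ lmax lmin γmax γmin) {θ} (hθ : θ ∈ Θ) :
    lmin ≤ lmax :=
  (hF.le_sigmaMin θ hθ).trans
    ((LinearMap.singularValues_antitone _ (Nat.zero_le d)).trans (hF.sigmaMax_le θ hθ))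

theorem integrable_density (hF : F.Assumptions Θ ω βZ lmax lmin γmax γmin) {θ} (hθ : θ ∈ Θ) :
    Integrable (F.density θ) F.ν := by
  have h := (hF.integrable_weight θ hθ).mul_const (Real.exp (-Real.log (F.Z θ)))
  exact h.congr (Filter.Eventually.of_forall fun x => (F.density_eq θ x).symm)

theorem integral_density (hF : F.Assumptions Θ ω βZ lmax lmin γmax γmin) {θ} (hθ : θ ∈ Θ) :
    ∫ x, F.density θ x ∂F.ν = 1 := by
  simp_rw [F.density_eq, integral_mul_const]
  change F.Z θ * _ = 1
  rw [Real.exp_neg, Real.exp_log (hF.Z_pos θ hθ), mul_inv_cancel₀ (hF.Z_pos θ hθ).ne']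

theorem integrable_density_mul (hF : F.Assumptions Θ ω βZ lmax lmin γmax γmin) {θ} (hθ : θ ∈ Θ)
    {f : X → ℝ} (hf : Measurable f) (a b : ℝ) (hfb : ∀ x, |f x| ≤ a + b * ‖F.T x‖ ^ 2) :
    Integrable (fun x => F.density θ x * f x) F.ν := by
  refine (((hF.integrable_density hθ).mul_const a).add
    ((hF.integrable_sq θ hθ).mul_const b)).mono'
    ((F.measurable_density θ).mul hf).aestronglyMeasurable (Filter.Eventually.of_forall fun x => ?_)
  rw [Real.norm_eq_abs, abs_mul, abs_of_nonneg (F.density_nonneg θ x)]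
  calc _ ≤ F.density θ x * (a + b * ‖F.T x‖ ^ 2) :=
        mul_le_mul_of_nonneg_left (hfb x) (F.density_nonneg θ x)
    _ = _ := by simp only [Pi.add_apply]; ring

theorem integrable_density_mul_apply_mul (hF : F.Assumptions Θ ω βZ lmax lmin γmax γmin) {θ}
    (hθ : θ ∈ Θ) (i j : Fin d ⊕ Unit) :
    Integrable (fun x => F.density θ x * (F.T x i * F.T x j)) F.ν := by
  have hT : ∀ i, Measurable fun x => F.T x i := fun i =>
    (measurable_pi_apply i).comp ((WithLp.measurable_ofLp 2 _).comp F.measurable_T)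
  refine hF.integrable_density_mul hθ ((hT i).mul (hT j)) 0 1 fun x => ?_
  have h := mul_le_mul (PiLp.norm_apply_le (F.T x) i) (PiLp.norm_apply_le (F.T x) j)
    (norm_nonneg _) (norm_nonneg _)
  rw [← norm_mul, Real.norm_eq_abs] at h
  linarith

theorem integrable_density_mul_inner (hF : F.Assumptions Θ ω βZ lmax lmin γmax γmin) {θ}
    (hθ : θ ∈ Θ) {f : X → ℝ} (hf : Measurable f) (hfb : ∀ x, |f x| ≤ 1) (v : ExtParam d) :
    Integrable (fun x => F.density θ x * (f x * ⟪v, F.T x⟫)) F.ν := by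
  refine hF.integrable_density_mul hθ (hf.mul (F.measurable_inner_T v)) ‖v‖ ‖v‖ fun x => ?_
  rw [abs_mul]
  have h1 := abs_real_inner_le_norm v (F.T x)
  have h2 := mul_le_mul (hfb x) h1 (abs_nonneg _) zero_le_one
  -- `‖T‖ ≤ 1 + ‖T‖²` reduces linear growth to the second moment.
  nlinarith [mul_nonneg (norm_nonneg v) (sq_nonneg (‖F.T x‖ - 1)),
    mul_nonneg (norm_nonneg v) (sq_nonneg ‖F.T x‖), norm_nonneg v]

theorem integrable_density_mul_inner_sq (hF : F.Assumptions Θ ω βZ lmax lmin γmax γmin) {θ}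
    (hθ : θ ∈ Θ) (v : ExtParam d) :
    Integrable (fun x => F.density θ x * ⟪v, F.T x⟫ ^ 2) F.ν := by
  refine hF.integrable_density_mul hθ ((F.measurable_inner_T v).pow_const 2) 0 (‖v‖ ^ 2) fun x => ?_
  rw [abs_of_nonneg (sq_nonneg _), zero_add, ← mul_pow]
  exact sq_le_sq' (by linarith [(abs_le.1 (abs_real_inner_le_norm v (F.T x))).1])
    (real_inner_le_norm _ _)

theorem integral_density_mul_inner_mul_inner (hF : F.Assumptions Θ ω βZ lmax lmin γmax γmin) {θ}
    (hθ : θ ∈ Θ) (v w : ExtParam d) :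
    ⟪Matrix.toEuclideanLin (F.fisher θ) v, w⟫
      = ∫ x, F.density θ x * (⟪v, F.T x⟫ * ⟪w, F.T x⟫) ∂F.ν := by
  have h1 : ∀ x, F.density θ x * (⟪v, F.T x⟫ * ⟪w, F.T x⟫)
      = ∑ i, ∑ j, w i * v j * (F.density θ x * (F.T x i * F.T x j)) := by
    intro x
    simp only [PiLp.inner_apply, RCLike.inner_apply, conj_trivial]
    rw [mul_comm (∑ i, _), Finset.sum_mul_sum, Finset.mul_sum]
    refine Finset.sum_congr rfl fun i _ => ?_
    rw [Finset.mul_sum]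
    exact Finset.sum_congr rfl fun j _ => by ring
  simp_rw [h1]
  rw [integral_finsetSum _ fun i _ => integrable_finsetSum _ fun j _ =>
    (hF.integrable_density_mul_apply_mul hθ i j).const_mul _]
  simp only [PiLp.inner_apply, RCLike.inner_apply, conj_trivial]
  refine Finset.sum_congr rfl fun i _ => ?_
  rw [integral_finsetSum _ fun j _ => (hF.integrable_density_mul_apply_mul hθ i j).const_mul _,
    Matrix.ofLp_toLpLin, Matrix.toLin'_apply, Matrix.mulVec, dotProduct, Finset.mul_sum]
  refine Finset.sum_congr rfl fun j _ => ?_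
  rw [integral_const_mul]
  simp only [fisher, Matrix.of_apply]
  ring

theorem integral_density_mul_inner_sq_bounds (hF : F.Assumptions Θ ω βZ lmax lmin γmax γmin) {θ}
    (hθ : θ ∈ Θ) (v : ExtParam d) :
    lmin * ‖v‖ ^ 2 ≤ ∫ x, F.density θ x * ⟪v, F.T x⟫ ^ 2 ∂F.ν ∧
      ∫ x, F.density θ x * ⟪v, F.T x⟫ ^ 2 ∂F.ν ≤ lmax * ‖v‖ ^ 2 := by
  have hpos : (Matrix.toEuclideanLin (F.fisher θ)).IsPositive := by
    refine ⟨fun v w => ?_, fun v => ?_⟩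
    · rw [hF.integral_density_mul_inner_mul_inner hθ, real_inner_comm,
        hF.integral_density_mul_inner_mul_inner hθ]
      simp_rw [mul_comm]
    · rw [hF.integral_density_mul_inner_mul_inner hθ]
      exact integral_nonneg fun x => mul_nonneg (F.density_nonneg θ x) (mul_self_nonneg _)
  have h := hpos.inner_apply_self_bounds (n := d) (by simp) v
  rw [hF.integral_density_mul_inner_mul_inner hθ] at h
  simp_rw [← sq] at h
  exact ⟨(mul_le_mul_of_nonneg_right (hF.le_sigmaMin θ hθ) (sq_nonneg _)).trans h.1,
    h.2.trans (mul_le_mul_of_nonneg_right (hF.sigmaMax_le θ hθ) (sq_nonneg _))⟩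

theorem integrable_model_mul_inner_sq (hF : F.Assumptions Θ ω βZ lmax lmin γmax γmin)
    {τ : ExtParam d} (hτ : ExtParam.natural τ ∈ Θ) (v : ExtParam d) :
    Integrable (fun x => F.model τ x * ⟪v, F.T x⟫ ^ 2) F.ν := by
  simp_rw [F.model_eq τ, mul_assoc]
  exact (hF.integrable_density_mul_inner_sq hτ v).const_mul _

theorem integral_model_mul_inner_sq_bounds (hF : F.Assumptions Θ ω βZ lmax lmin γmax γmin)
    {τ : ExtParam d} (hτ : ExtParam.natural τ ∈ Θ) (v : ExtParam d) :
    Real.exp (F.logMass τ) * (lmin * ‖v‖ ^ 2) ≤ ∫ x, F.model τ x * ⟪v, F.T x⟫ ^ 2 ∂F.ν ∧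
      ∫ x, F.model τ x * ⟪v, F.T x⟫ ^ 2 ∂F.ν ≤ Real.exp (F.logMass τ) * (lmax * ‖v‖ ^ 2) := by
  have h := hF.integral_density_mul_inner_sq_bounds hτ v
  simp_rw [F.model_eq τ, mul_assoc]
  rw [integral_const_mul]
  exact ⟨mul_le_mul_of_nonneg_left h.1 (Real.exp_nonneg _),
    mul_le_mul_of_nonneg_left h.2 (Real.exp_nonneg _)⟩

theorem abs_logMass_add_sub_le (hF : F.Assumptions Θ ω βZ lmax lmin γmax γmin)
    {τ u : ExtParam d} (hτ : ExtParam.natural τ ∈ Θ) (hu : ExtParam.natural (τ + u) ∈ Θ) :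
    |F.logMass (τ + u) - F.logMass τ| ≤ (βZ + 1) * ‖u‖ := by
  have h1 := hF.logZ_lipschitz _ hu _ hτ
  rw [map_add, add_sub_cancel_left, ← map_add] at h1
  have h2 := mul_le_mul_of_nonneg_left (ExtParam.norm_natural_le u) hF.βZ_pos.le
  have h3 := ExtParam.abs_inr_le u
  have h4 : F.logMass (τ + u) - F.logMass τ = Real.log (F.Z (ExtParam.natural (τ + u)))
      - Real.log (F.Z (ExtParam.natural τ)) - u (Sum.inr ()) := by
    simp only [logMass, PiLp.add_apply]; ring
  rw [h4]
  exact (abs_sub _ _).trans (by linarith)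

/-- The geometric mean of two members is the unnormalized model at the midpoint of their extended
parameters; BC is its mass. -/
theorem bhattacharyya_eq_exp (hF : F.Assumptions Θ ω βZ lmax lmin γmax γmin)
    {θ₁ θ₂ : EuclideanSpace ℝ (Fin d)}
    (hmid : ExtParam.natural ((1 / 2 : ℝ) • (F.ext θ₁ + F.ext θ₂)) ∈ Θ) :
    F.bhattacharyya θ₁ θ₂ = Real.exp (F.logMass ((1 / 2 : ℝ) • (F.ext θ₁ + F.ext θ₂))) := by
  have h : ∀ x, √(F.density θ₁ x * F.density θ₂ x)
      = F.model ((1 / 2 : ℝ) • (F.ext θ₁ + F.ext θ₂)) x := by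
    intro x
    rw [Real.sqrt_eq_iff_mul_self_eq (mul_nonneg (F.density_nonneg _ x) (F.density_nonneg _ x))
      (F.model_nonneg _ x)]
    simp only [density, model, inner_smul_left, inner_add_left, conj_trivial]
    have : ∀ a b : ℝ, Real.exp a * Real.exp b
        = Real.exp (1 / 2 * (a + b)) * Real.exp (1 / 2 * (a + b)) := by
      intro a b
      rw [← Real.exp_add, ← Real.exp_add]
      congr 1
      ring
    linear_combination F.h x ^ 2 * this ⟪F.ext θ₁, F.T x⟫ ⟪F.ext θ₂, F.T x⟫
  unfold bhattacharyya
  simp_rw [h, F.model_eq]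
  rw [integral_const_mul, hF.integral_density hmid, mul_one]

theorem bhattacharyya_le_one (hF : F.Assumptions Θ ω βZ lmax lmin γmax γmin)
    {θ₁ θ₂ : EuclideanSpace ℝ (Fin d)} (h₁ : θ₁ ∈ Θ) (h₂ : θ₂ ∈ Θ) :
    F.bhattacharyya θ₁ θ₂ ≤ 1 := by
  have h : ∫ x, (1 / 2) * (F.density θ₁ x + F.density θ₂ x) ∂F.ν = 1 := by
    rw [integral_const_mul, integral_add (hF.integrable_density h₁) (hF.integrable_density h₂),
      hF.integral_density h₁, hF.integral_density h₂]
    norm_num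
  rw [← h]
  refine integral_mono_of_nonneg (Filter.Eventually.of_forall fun x => Real.sqrt_nonneg _)
    (((hF.integrable_density h₁).add (hF.integrable_density h₂)).const_mul _)
    (Filter.Eventually.of_forall fun x => ?_)
  refine Real.sqrt_le_iff.2 ⟨?_, ?_⟩
  · linarith [F.density_nonneg θ₁ x, F.density_nonneg θ₂ x]
  · nlinarith [sq_nonneg (F.density θ₁ x - F.density θ₂ x)]

/-! ### The NCE loss: logistic form, gradient and growth -/

theorem integrable_density_mul_softplus (hF : F.Assumptions Θ ω βZ lmax lmin γmax γmin) {θ}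
    (hθ : θ ∈ Θ) (v : ExtParam d) :
    Integrable (fun x => F.density θ x * softplus ⟪v, F.T x⟫) F.ν := by
  refine hF.integrable_density_mul hθ (measurable_softplus.comp (F.measurable_inner_T v))
    (Real.log 2 + ‖v‖) ‖v‖ fun x => (abs_softplus_le _).trans ?_
  have h1 := abs_real_inner_le_norm v (F.T x)
  nlinarith [mul_nonneg (norm_nonneg v) (sq_nonneg (‖F.T x‖ - 1)),
    mul_nonneg (norm_nonneg v) (sq_nonneg ‖F.T x‖), norm_nonneg v]

theorem integrable_density_mul_inner_T (hF : F.Assumptions Θ ω βZ lmax lmin γmax γmin) {θ}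
    (hθ : θ ∈ Θ) (v : ExtParam d) :
    Integrable (fun x => F.density θ x * ⟪v, F.T x⟫) F.ν := by
  simpa using hF.integrable_density_mul_inner hθ (measurable_const (a := (1 : ℝ))) (by simp) v

theorem integrable_density_mul_logistic (hF : F.Assumptions Θ ω βZ lmax lmin γmax γmin) {θ}
    (hθ : θ ∈ Θ) (u v : ExtParam d) :
    Integrable (fun x => F.density θ x * (logistic ⟪u, F.T x⟫ * ⟪v, F.T x⟫)) F.ν :=
  hF.integrable_density_mul_inner hθ (measurable_logistic.comp (F.measurable_inner_T u))
    (fun _ => abs_le.2 ⟨(by norm_num : (-1 : ℝ) ≤ 0).trans (logistic_nonneg _), logistic_le_one _⟩) v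

theorem integrable_nceIntegrand (hF : F.Assumptions Θ ω βZ lmax lmin γmax γmin)
    {θstar θq : EuclideanSpace ℝ (Fin d)} (hs : θstar ∈ Θ) (hq : θq ∈ Θ) (v : ExtParam d) :
    Integrable (fun x => (F.density θstar x + F.density θq x) * softplus ⟪v, F.T x⟫
      - F.density θstar x * ⟪v, F.T x⟫) F.ν := by
  simp_rw [add_mul]
  exact ((hF.integrable_density_mul_softplus hs v).add
    (hF.integrable_density_mul_softplus hq v)).sub (hF.integrable_density_mul_inner_T hs v)

theorem nceLoss_eq (hF : F.Assumptions Θ ω βZ lmax lmin γmax γmin)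
    {θstar θq : EuclideanSpace ℝ (Fin d)} (hs : θstar ∈ Θ) (hq : θq ∈ Θ) (τ : ExtParam d) :
    F.nceLoss θstar θq τ = 1 / 2 * ∫ x, ((F.density θstar x + F.density θq x)
      * softplus ⟪τ - F.ext θq, F.T x⟫ - F.density θstar x * ⟪τ - F.ext θq, F.T x⟫) ∂F.ν := by
  have hm : ∀ x, F.model τ x = F.density θq x * Real.exp ⟪τ - F.ext θq, F.T x⟫ := by
    intro x
    rw [density, model, model, mul_assoc, ← Real.exp_add, inner_sub_left, add_sub_cancel]
  have h1 : ∀ x, F.density θstar x * Real.log ((F.model τ x + F.density θq x) / F.model τ x)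
      = F.density θstar x * softplus ⟪τ - F.ext θq, F.T x⟫
        - F.density θstar x * ⟪τ - F.ext θq, F.T x⟫ := by
    intro x
    -- Where `h` vanishes the quotient is `0 / 0`, but the density factor kills both sides.
    rcases (F.h_nonneg x).eq_or_lt with h | h
    · simp [density, model, ← h]
    · have hq' : 0 < F.density θq x := mul_pos h (Real.exp_pos _)
      set s := ⟪τ - F.ext θq, F.T x⟫
      have h2 : (F.model τ x + F.density θq x) / F.model τ x
          = (1 + Real.exp s) / Real.exp s := by
        rw [hm x]; field_simp; ring
      rw [h2, Real.log_div (by positivity) (Real.exp_ne_zero _), Real.log_exp, softplus, mul_sub]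
  have h2 : ∀ x, F.density θq x * Real.log ((F.model τ x + F.density θq x) / F.density θq x)
      = F.density θq x * softplus ⟪τ - F.ext θq, F.T x⟫ := by
    intro x
    rcases (F.h_nonneg x).eq_or_lt with h | h
    · simp [density, model, ← h]
    · have hq' : 0 < F.density θq x := mul_pos h (Real.exp_pos _)
      rw [hm x, softplus]
      congr 2
      field_simp
      ring
  unfold nceLoss
  simp_rw [h1, h2]
  rw [← mul_add, ← integral_add ((hF.integrable_density_mul_softplus hs _).sub'
    (hF.integrable_density_mul_inner_T hs _)) (hF.integrable_density_mul_softplus hq _)]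
  congr 2
  funext x
  ring

theorem integrable_nceSlope_mul_inner (hF : F.Assumptions Θ ω βZ lmax lmin γmax γmin)
    {θstar θq : EuclideanSpace ℝ (Fin d)} (hs : θstar ∈ Θ) (hq : θq ∈ Θ) (u v : ExtParam d) :
    Integrable (fun x => ((F.density θstar x + F.density θq x) * logistic ⟪u, F.T x⟫
      - F.density θstar x) * ⟪v, F.T x⟫) F.ν := by
  refine (((hF.integrable_density_mul_logistic hs u v).add
    (hF.integrable_density_mul_logistic hq u v)).sub
    (hF.integrable_density_mul_inner_T hs v)).congr (Filter.Eventually.of_forall fun x => ?_)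
  simp only [Pi.add_apply, Pi.sub_apply]
  ring

theorem inner_nceGrad (hF : F.Assumptions Θ ω βZ lmax lmin γmax γmin)
    {θstar θq : EuclideanSpace ℝ (Fin d)} (hs : θstar ∈ Θ) (hq : θq ∈ Θ) (τ v : ExtParam d) :
    ⟪F.nceGrad θstar θq τ, v⟫ = 1 / 2 * ∫ x, ((F.density θstar x + F.density θq x)
      * logistic ⟪τ - F.ext θq, F.T x⟫ - F.density θstar x) * ⟪v, F.T x⟫ ∂F.ν := by
  have hc : Integrable (fun x => ((F.density θstar x + F.density θq x)
      * logistic ⟪τ - F.ext θq, F.T x⟫ - F.density θstar x) • F.T x) F.ν := by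
    refine Integrable.of_eval_piLp fun i => ?_
    have h := hF.integrable_nceSlope_mul_inner hs hq (τ - F.ext θq) (EuclideanSpace.single i 1)
    simpa [EuclideanSpace.inner_single_left] using h
  rw [nceGrad, real_inner_smul_left, real_inner_comm, ← integral_inner hc]
  simp_rw [inner_smul_right]

theorem nceLoss_add_sub (hF : F.Assumptions Θ ω βZ lmax lmin γmax γmin)
    {θstar θq : EuclideanSpace ℝ (Fin d)} (hs : θstar ∈ Θ) (hq : θq ∈ Θ) (τ v : ExtParam d) :
    F.nceLoss θstar θq (τ + v) - F.nceLoss θstar θq τ - ⟪F.nceGrad θstar θq τ, v⟫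
      = 1 / 2 * ∫ x, (F.density θstar x + F.density θq x)
        * (softplus (⟪τ - F.ext θq, F.T x⟫ + ⟪v, F.T x⟫) - softplus ⟪τ - F.ext θq, F.T x⟫
          - logistic ⟪τ - F.ext θq, F.T x⟫ * ⟪v, F.T x⟫) ∂F.ν := by
  rw [hF.nceLoss_eq hs hq, hF.nceLoss_eq hs hq, hF.inner_nceGrad hs hq, ← mul_sub, ← mul_sub,
    ← integral_sub (hF.integrable_nceIntegrand hs hq _) (hF.integrable_nceIntegrand hs hq _),
    ← integral_sub ((hF.integrable_nceIntegrand hs hq _).sub'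
      (hF.integrable_nceIntegrand hs hq _)) (hF.integrable_nceSlope_mul_inner hs hq _ _)]
  congr 2
  funext x
  rw [add_sub_right_comm, inner_add_left]
  ring

theorem nceLoss_add_sub_nonneg (hF : F.Assumptions Θ ω βZ lmax lmin γmax γmin)
    {θstar θq : EuclideanSpace ℝ (Fin d)} (hs : θstar ∈ Θ) (hq : θq ∈ Θ) (τ v : ExtParam d) :
    0 ≤ F.nceLoss θstar θq (τ + v) - F.nceLoss θstar θq τ - ⟪F.nceGrad θstar θq τ, v⟫ := by
  rw [hF.nceLoss_add_sub hs hq]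
  refine mul_nonneg (by norm_num) (integral_nonneg fun x => mul_nonneg ?_ (le_softplus_add _ _))
  exact add_nonneg (F.density_nonneg _ x) (F.density_nonneg _ x)

theorem nceLoss_add_sub_le (hF : F.Assumptions Θ ω βZ lmax lmin γmax γmin)
    {θstar θq : EuclideanSpace ℝ (Fin d)} (hs : θstar ∈ Θ) (hq : θq ∈ Θ) (τ v : ExtParam d) :
    F.nceLoss θstar θq (τ + v) - F.nceLoss θstar θq τ - ⟪F.nceGrad θstar θq τ, v⟫
      ≤ lmax / 2 * ‖v‖ ^ 2 := by
  have hi := ((hF.integrable_density_mul_inner_sq hs v).add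
    (hF.integrable_density_mul_inner_sq hq v)).const_mul (1 / 2)
  have h : ∫ x, (F.density θstar x + F.density θq x)
        * (softplus (⟪τ - F.ext θq, F.T x⟫ + ⟪v, F.T x⟫) - softplus ⟪τ - F.ext θq, F.T x⟫
          - logistic ⟪τ - F.ext θq, F.T x⟫ * ⟪v, F.T x⟫) ∂F.ν
      ≤ ∫ x, 1 / 2 * (F.density θstar x * ⟪v, F.T x⟫ ^ 2 + F.density θq x * ⟪v, F.T x⟫ ^ 2) ∂F.ν := by
    have hn : ∀ x, 0 ≤ F.density θstar x + F.density θq x := fun x =>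
      add_nonneg (F.density_nonneg _ x) (F.density_nonneg _ x)
    refine integral_mono_of_nonneg
      (Filter.Eventually.of_forall fun x => mul_nonneg (hn x) (le_softplus_add _ _)) hi
      (Filter.Eventually.of_forall fun x =>
        (mul_le_mul_of_nonneg_left (softplus_add_le _ _) (hn x)).trans_eq ?_)
    ring
  rw [integral_const_mul, integral_add (hF.integrable_density_mul_inner_sq hs v)
    (hF.integrable_density_mul_inner_sq hq v)] at h
  rw [hF.nceLoss_add_sub hs hq]
  have h1 := (hF.integral_density_mul_inner_sq_bounds hs v).2
  have h2 := (hF.integral_density_mul_inner_sq_bounds hq v).2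
  linarith

theorem gradient_nceLoss (hF : F.Assumptions Θ ω βZ lmax lmin γmax γmin)
    {θstar θq : EuclideanSpace ℝ (Fin d)} (hs : θstar ∈ Θ) (hq : θq ∈ Θ) (τ : ExtParam d) :
    gradient (F.nceLoss θstar θq) τ = F.nceGrad θstar θq τ :=
  (hasGradientAt_of_quadratic_bounds (hF.nceLoss_add_sub_nonneg hs hq τ)
    (hF.nceLoss_add_sub_le hs hq τ)).gradient

/-- The shift by `u/4` from the midpoint costs a factor `e^{-r/4}` in mass, and the shift by `u`
from `τ_*` a factor `e^r`; the integrated pointwise bound combines them. -/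
theorem le_inner_nceGrad (hF : F.Assumptions Θ ω βZ lmax lmin γmax γmin)
    {θstar θq : EuclideanSpace ℝ (Fin d)} (hs : θstar ∈ Θ) (hq : θq ∈ Θ) {u : ExtParam d} {r : ℝ}
    (hmid : ExtParam.natural ((1 / 2 : ℝ) • (F.ext θstar + F.ext θq)) ∈ Θ)
    (hmid' : ExtParam.natural ((1 / 2 : ℝ) • (F.ext θstar + F.ext θq) + (1 / 4 : ℝ) • u) ∈ Θ)
    (hu : ExtParam.natural (F.ext θstar + u) ∈ Θ) (hr : (βZ + 1) * ‖u‖ ≤ r) :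
    F.bhattacharyya θstar θq ^ 2 * lmin ^ 2 / (4 * lmax) * Real.exp (-(3 / 2 * r)) * ‖u‖ ^ 2
      ≤ ⟪F.nceGrad θstar θq (F.ext θstar + u), u⟫ := by
  have hlmin := hF.lmin_pos
  have hlmax : 0 < lmax := hlmin.trans_le (hF.lmin_le_lmax hs)
  have hβ := hF.βZ_pos
  have hr0 : 0 ≤ r := le_trans (by positivity) hr
  set B := F.bhattacharyya θstar θq with hB
  set τm := (1 / 2 : ℝ) • (F.ext θstar + F.ext θq) with hτm
  -- The maximizer of `2κA - κ²S` for `A = B e^{-r/4} lmin ‖u‖²` and `S = 2 e^r lmax ‖u‖²`, the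
  -- bounds `c1` and `c2`.
  set κ := B * lmin / (2 * lmax) * Real.exp (-(5 / 4 * r)) with hκ
  have hB0 : 0 < B := by rw [hB, hF.bhattacharyya_eq_exp hmid]; exact Real.exp_pos _
  have hκ0 : 0 < κ := by positivity
  have hpt : ∀ x, 2 * κ * (F.model (τm + (1 / 4 : ℝ) • u) x * ⟪u, F.T x⟫ ^ 2)
      - κ ^ 2 * (F.model (F.ext θstar + u) x * ⟪u, F.T x⟫ ^ 2
        + F.density θq x * ⟪u, F.T x⟫ ^ 2)
      ≤ ((F.density θstar x + F.density θq x)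
      * logistic ⟪F.ext θstar + u - F.ext θq, F.T x⟫ - F.density θstar x) * ⟪u, F.T x⟫ := by
    intro x
    have h := le_nce_slope_mul (F.h_nonneg x) ⟪F.ext θstar, F.T x⟫ ⟪F.ext θq, F.T x⟫
      ⟪u, F.T x⟫ κ
    simp only [density, model, τm, inner_add_left, inner_sub_left, real_inner_smul_left]
    convert h using 6
    ring
  have i1 := hF.integrable_model_mul_inner_sq hmid' u
  have i2 := hF.integrable_model_mul_inner_sq hu u
  have i3 := hF.integrable_density_mul_inner_sq hq u
  have hint := integral_mono ((i1.const_mul (2 * κ)).sub' ((i2.fun_add i3).const_mul (κ ^ 2)))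
    (hF.integrable_nceSlope_mul_inner hs hq _ _) hpt
  rw [integral_sub (i1.const_mul _) ((i2.fun_add i3).const_mul _), integral_const_mul,
    integral_const_mul, integral_add i2 i3] at hint
  have b1 := (hF.integral_model_mul_inner_sq_bounds hmid' u).1
  have b2 := (hF.integral_model_mul_inner_sq_bounds hu u).2
  have b3 := (hF.integral_density_mul_inner_sq_bounds hq u).2
  have m1 : B * Real.exp (-(r / 4)) ≤ Real.exp (F.logMass (τm + (1 / 4 : ℝ) • u)) := by
    rw [hB, hF.bhattacharyya_eq_exp hmid, ← Real.exp_add]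
    have := (abs_le.1 (hF.abs_logMass_add_sub_le hmid hmid')).1
    rw [norm_smul, Real.norm_of_nonneg (by norm_num)] at this
    exact Real.exp_le_exp.2 (by linarith)
  have m2 : Real.exp (F.logMass (F.ext θstar + u)) ≤ Real.exp r := by
    have := (abs_le.1 (hF.abs_logMass_add_sub_le (τ := F.ext θstar) hs hu)).2
    have h0 : F.logMass (F.ext θstar) = 0 := sub_self _
    exact Real.exp_le_exp.2 (by linarith)
  have m3 : 1 ≤ Real.exp r := Real.one_le_exp hr0
  have c1 : B * Real.exp (-(r / 4)) * (lmin * ‖u‖ ^ 2)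
      ≤ ∫ x, F.model (τm + (1 / 4 : ℝ) • u) x * ⟪u, F.T x⟫ ^ 2 ∂F.ν :=
    (mul_le_mul_of_nonneg_right m1 (by positivity)).trans b1
  have c2 : (∫ x, F.model (F.ext θstar + u) x * ⟪u, F.T x⟫ ^ 2 ∂F.ν)
      + ∫ x, F.density θq x * ⟪u, F.T x⟫ ^ 2 ∂F.ν ≤ 2 * Real.exp r * (lmax * ‖u‖ ^ 2) := by
    have h0 : 0 ≤ lmax * ‖u‖ ^ 2 := by positivity
    nlinarith [mul_le_mul_of_nonneg_right m2 h0, mul_le_mul_of_nonneg_right m3 h0]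
  have d1 := mul_le_mul_of_nonneg_left c1 (show 0 ≤ 2 * κ by positivity)
  have d2 := mul_le_mul_of_nonneg_left c2 (sq_nonneg κ)
  have e1 : κ * Real.exp (-(r / 4)) = B * lmin / (2 * lmax) * Real.exp (-(3 / 2 * r)) := by
    rw [hκ, mul_assoc, ← Real.exp_add]; ring_nf
  have e2 : κ ^ 2 * Real.exp r
      = (B * lmin / (2 * lmax)) ^ 2 * Real.exp (-(3 / 2 * r)) := by
    rw [hκ, mul_pow, mul_assoc, ← Real.exp_nat_mul, ← Real.exp_add]; push_cast; ring_nf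
  have e3 : 2 * κ * (B * Real.exp (-(r / 4)) * (lmin * ‖u‖ ^ 2))
      - κ ^ 2 * (2 * Real.exp r * (lmax * ‖u‖ ^ 2))
      = 2 * (B ^ 2 * lmin ^ 2 / (4 * lmax) * Real.exp (-(3 / 2 * r)) * ‖u‖ ^ 2) := by
    calc _ = 2 * (κ * Real.exp (-(r / 4))) * (B * (lmin * ‖u‖ ^ 2))
          - 2 * (κ ^ 2 * Real.exp r) * (lmax * ‖u‖ ^ 2) := by ring
      _ = _ := by rw [e1, e2]; field_simp; ring
  rw [hF.inner_nceGrad hs hq]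
  linarith

/-- Along the ray from `τ_*` to `τ` the slope found at radius `δ/2` persists by convexity, and at
least another `δ/2` remains to be travelled. -/
theorem le_nceLoss_sub (hF : F.Assumptions Θ ω βZ lmax lmin γmax γmin)
    {θstar θq : EuclideanSpace ℝ (Fin d)} (hs : θstar ∈ Θ) (hq : θq ∈ Θ) {δ c : ℝ} (hδ : 0 < δ)
    (hc : 0 ≤ c)
    (hslope : ∀ u : ExtParam d, ‖u‖ = δ / 2 → c ≤ ⟪F.nceGrad θstar θq (F.ext θstar + u), u⟫)
    {τ : ExtParam d} (hτ : δ < ‖τ - F.ext θstar‖) :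
    c ≤ F.nceLoss θstar θq τ - F.nceLoss θstar θq (F.ext θstar) := by
  set D := ‖τ - F.ext θstar‖ with hD
  have hD0 : 0 < D := hδ.trans hτ
  set u := (δ / (2 * D)) • (τ - F.ext θstar) with hu
  have hnu : ‖u‖ = δ / 2 := by
    rw [hu, norm_smul, Real.norm_of_nonneg (by positivity), ← hD]; field_simp
  have h1 := hslope u hnu
  have h2 := hF.nceLoss_add_sub_nonneg hs hq (F.ext θstar) u
  have h3 := hF.nceLoss_add_sub_nonneg hs hq (F.ext θstar + u) ((2 * D / δ - 1) • u)
  have h4 : F.ext θstar + u + (2 * D / δ - 1) • u = τ := by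
    have : (2 * D / δ) • u = τ - F.ext θstar := by
      rw [hu, smul_smul, show 2 * D / δ * (δ / (2 * D)) = 1 by field_simp, one_smul]
    rw [sub_smul, one_smul, this]
    abel
  rw [F.nceGrad_ext_star, inner_zero_left] at h2
  rw [h4, inner_smul_right] at h3
  have h5 : 1 ≤ 2 * D / δ - 1 := by
    have : 2 ≤ 2 * D / δ := (le_div_iff₀ hδ).2 (by linarith)
    linarith
  nlinarith [mul_le_mul h5 h1 hc (by linarith)]

end Assumptions
end ExpFamily

/-! ### Assembly of the constants -/

theorem mainTheorem4 {X : Type*} [MeasurableSpace X] {d : ℕ} (F : ExpFamily X d)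
    (Θ : Set (EuclideanSpace ℝ (Fin d))) (hΘ : Convex ℝ Θ)
    (ω βZ lmax lmin γmax γmin : ℝ)
    (hF : F.Assumptions Θ ω βZ lmax lmin γmax γmin)
    (θstar θq : EuclideanSpace ℝ (Fin d))
    (δ : ℝ) (hδ : 0 < δ) (hδβ : δ ≤ 1 / βZ)
    (hstar : Metric.closedBall θstar δ ⊆ Θ) (hq : Metric.closedBall θq δ ⊆ Θ)
    (ρ : ℝ) (hρ : 0 ≤ ρ) (hρβ : ρ ≤ 1 / βZ) :
    let C := rateConst βZ lmax lmin γmax γmin ρ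
    let BC := F.bhattacharyya θstar θq
    let η := δ * Real.sqrt (BC ^ 3 / C)
    ∃ t : ℕ,
      (t : ℝ) ≤ C * (1 / BC ^ 3) * (‖F.ext θq - F.ext θstar‖ ^ 2 / δ ^ 2) ∧
      ‖ngd (F.nceLoss θstar θq) η (F.ext θq) t - F.ext θstar‖ ≤ δ := by
  intro C BC η
  have hs : θstar ∈ Θ := hstar (Metric.mem_closedBall_self hδ.le)
  have hqm : θq ∈ Θ := hq (Metric.mem_closedBall_self hδ.le)
  have hβ := hF.βZ_pos
  have hlmin := hF.lmin_pos
  have hll := hF.lmin_le_lmax hs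
  have hlmax : 0 < lmax := hlmin.trans_le hll
  have hC : 36 * Real.exp (2 / βZ) * (lmax / lmin) ^ 3 ≤ C :=
    ExpFamily.le_rateConst hlmin hll hF.γmax_nonneg hF.γmin_nonneg hρ
  have hκ : 1 ≤ lmax / lmin := (one_le_div hlmin).2 hll
  have hexp : 1 ≤ Real.exp (2 / βZ) := Real.one_le_exp (by positivity)
  have hκ3 : 1 ≤ (lmax / lmin) ^ 3 := one_le_pow₀ hκ
  have hC1 : 1 ≤ C := by nlinarith
  have hC0 : 0 < C := by linarith
  have hball : ∀ u : ExtParam d, ‖u‖ ≤ δ → ExtParam.natural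
      ((1 / 2 : ℝ) • (F.ext θstar + F.ext θq) + u) ∈ Θ := by
    intro u hu
    have hn := (ExtParam.norm_natural_le u).trans hu
    have h1 : θstar + ExtParam.natural u ∈ Θ := hstar (by simpa [dist_eq_norm] using hn)
    have h2 : θq + ExtParam.natural u ∈ Θ := hq (by simpa [dist_eq_norm] using hn)
    have h3 := hΘ h1 h2 (show (0 : ℝ) ≤ 1 / 2 by norm_num) (show (0 : ℝ) ≤ 1 / 2 by norm_num)
      (by norm_num)
    convert h3 using 1
    rw [map_add, map_smul, map_add, F.natural_ext, F.natural_ext]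
    module
  have hmid : ExtParam.natural ((1 / 2 : ℝ) • (F.ext θstar + F.ext θq)) ∈ Θ := by
    simpa using hball 0 (by simpa using hδ.le)
  have hBC0 : 0 < BC := by
    simp only [BC]; rw [hF.bhattacharyya_eq_exp hmid]; exact Real.exp_pos _
  have hBC1 : BC ≤ 1 := hF.bhattacharyya_le_one hs hqm
  have hη0 : 0 < η := by positivity
  have hη2 : η ^ 2 = δ ^ 2 * (BC ^ 3 / C) := by
    simp only [η]; rw [mul_pow, Real.sq_sqrt (by positivity)]
  have hηδ : η ≤ δ := by
    refine mul_le_of_le_one_right hδ.le (Real.sqrt_le_one.2 ?_)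
    rw [div_le_one hC0]
    exact (pow_le_one₀ hBC0.le hBC1).trans hC1
  -- Bounds `(βZ + 1)‖u‖` on the sphere `‖u‖ = δ/2`, because `δ ≤ 1 / βZ`.
  set r := (1 + 1 / βZ) / 2 with hr
  set c := BC ^ 2 * lmin ^ 2 / (4 * lmax) * Real.exp (-(3 / 2 * r)) * (δ / 2) ^ 2 with hc
  have hc0 : 0 < c := by positivity
  have hslope : ∀ u : ExtParam d, ‖u‖ = δ / 2 →
      c ≤ inner ℝ (F.nceGrad θstar θq (F.ext θstar + u)) u := by
    intro u hu
    have h := hF.le_inner_nceGrad hs hqm (u := u) (r := r) hmid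
      (hball _ (by rw [norm_smul, hu, Real.norm_of_nonneg (by norm_num)]; linarith))
      (hstar ?_) ?_
    · rwa [hu] at h
    · have h1 := ExtParam.norm_natural_le u
      rw [map_add, F.natural_ext, Metric.mem_closedBall, dist_eq_norm, add_sub_cancel_left]
      linarith
    · rw [hu, hr]
      have h1 : (βZ + 1) * δ ≤ (βZ + 1) * (1 / βZ) := mul_le_mul_of_nonneg_left hδβ (by positivity)
      have h2 : (βZ + 1) * (1 / βZ) = 1 + 1 / βZ := by field_simp
      linarith
  have hηc : lmax / 2 * η ^ 2 ≤ c := by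
    have h1 : Real.exp (3 / 2 * r) ≤ 3 * Real.exp (2 / βZ) := by
      have h2 : 3 / 2 * r ≤ 1 + 2 / βZ := by
        have h3 : 0 < 1 / βZ := by positivity
        have h4 : 2 / βZ = 2 * (1 / βZ) := by ring
        rw [hr, h4]; linarith
      have h3 := Real.exp_le_exp.2 h2
      rw [Real.exp_add] at h3
      nlinarith [Real.exp_one_lt_d9]
    -- `c` carries `BC²` and `η²` carries `BC³`: the surplus factor is at most 1, and `8 · 3 = 24`
    -- fits into 36.
    have h2 : 8 * Real.exp (3 / 2 * r) * (lmax / lmin) ^ 2 * BC ≤ C := by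
      have h3 : (lmax / lmin) ^ 2 ≤ (lmax / lmin) ^ 3 := pow_le_pow_right₀ hκ (by norm_num)
      calc _ ≤ 8 * (3 * Real.exp (2 / βZ)) * (lmax / lmin) ^ 3 * 1 := by gcongr
        _ ≤ 36 * Real.exp (2 / βZ) * (lmax / lmin) ^ 3 := by
          have : 0 ≤ Real.exp (2 / βZ) * (lmax / lmin) ^ 3 := by positivity
          linarith
        _ ≤ C := hC
    have h3 : lmax / 2 * η ^ 2
        = c * (8 * Real.exp (3 / 2 * r) * (lmax / lmin) ^ 2 * BC) / C := by
      rw [hη2, hc, Real.exp_neg]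
      field_simp
      ring
    rw [h3, div_le_iff₀ hC0]
    exact mul_le_mul_of_nonneg_left h2 hc0.le
  obtain ⟨t, ht, ht'⟩ := exists_ngd_norm_sub_le (L := F.nceLoss θstar θq) hη0 hηδ (F.ext θstar)
    (F.ext θq) (fun τ hτ => by
      have hgap := hF.le_nceLoss_sub hs hqm hδ hc0.le hslope hτ
      rw [hF.gradient_nceLoss hs hqm]
      refine mul_norm_le_inner_of_forall_le (G := F.nceGrad θstar θq) hη0.le
        (L := F.nceLoss θstar θq) (fun y => ?_) (by linarith) fun v hv => ?_
      · have := hF.nceLoss_add_sub_nonneg hs hqm τ (y - τ)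
        rw [add_sub_cancel] at this
        linarith
      · have := hF.nceLoss_add_sub_le hs hqm (F.ext θstar) v
        rw [F.nceGrad_ext_star, inner_zero_left, hv] at this
        linarith)
  refine ⟨t, ht.trans_eq ?_, ht'⟩
  rw [hη2]
  field_simp
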